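/- Let $(\tilde M,J,g)$ be a locally conformal Kähler (LCK) manifold, i.e. a complex manifold with a Hermitian metric $g$ such that every point has an open neighbourhood $U$ and a smooth function $u:U\to\mathbb R$ for which $e^{-u}g|_U$ is a Kähler metric (its Levi-Civita connection satisfies $\nabla J=0$). Let $\Omega(X,Y)=g(X,JY)$, let $\alpha$ be a Lee form of $\tilde M$, i.e. a closed $1$-form on $\tilde M$ with $d\Omega=\alpha\wedge\Omega$, and let $\alpha^{\#}$ be the Lee vector field, defined by $g(\alpha^{\#},X)=\alpha(X)$. Let $(N^T,g_1)$ and $(N^\theta,g_2)$ be Riemannian manifolds, let $f$ be a positive smooth function on $N^T$, and let $M=N^T\times_f N^\theta$ be the product manifold with the warped product metric $\pi_1^*g_1+(f\circ\pi_1)^2\,\pi_2^*g_2$. Suppose that $\varphi:M\to\tilde M$ is a smooth isometric immersion, and let $\mathfrak D$ and $\mathfrak D^\theta$ be the distributions (regarded as tangent to $\tilde M$ along $\varphi$) tangent to the factors $N^T$ and $N^\theta$. Suppose that $M$ is a proper pointwise semi-slant warped product in $\tilde M$ with slant function $\theta:M\to\mathbb R$, that is: - $\mathfrak D$ is holomorphic: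 $J\mathfrak D=\mathfrak D$; - $\mathfrak D^\theta$ is pointwise slant: $P^2Z=-(\cos^2\theta)Z$ for all $Z\in\mathfrak D^\theta$, where $PX$ denotes the component of $JX$ tangent to $M$; - $\dim N^T\neq 0$ and $\cos^2\theta>0$ everywhere on $M$. Then $\alpha^{\#}$ is orthogonal to $\mathfrak D^\theta$: $g(\alpha^{\#},Z)=0$ at every point of $M$ and for every $Z\in\mathfrak D^\theta$. -/

import Mathlib

open Set Bundle
open scoped Manifold ContDiff Topology

noncomputable section

namespace LCK

/-! ## Complex manifolds as real manifolds with a complex structure -/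

section Ambient

variable {E : Type*} [NormedAddCommGroup E] [NormedSpace ℂ E]
  {M : Type*} [TopologicalSpace M] [ChartedSpace E M]

/-- A complex manifold (holomorphic atlas) is a smooth real manifold. -/
instance realManifold [IsManifold 𝓘(ℂ, E) ω M] : IsManifold 𝓘(ℝ, E) ∞ M := by
  refine isManifold_of_contDiffOn 𝓘(ℝ, E) ∞ M fun e e' he he' => ?_
  have h := (contDiffGroupoid ω 𝓘(ℂ, E)).compatible he he'
  rw [contDiffGroupoid, mem_groupoid_of_pregroupoid] at h
  exact (ContDiffOn.restrict_scalars ℝ h.1).of_le le_top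

/-- The complex structure `J` of a complex manifold: multiplication by `i` on each tangent space.
(The tangent space at `x` is read in a holomorphic chart at `x`; transition maps have complex
linear derivatives, so this does not depend on the chart.) -/
def J (x : M) : TangentSpace 𝓘(ℝ, E) x →L[ℝ] TangentSpace 𝓘(ℝ, E) x :=
  ((Complex.I • ContinuousLinearMap.id ℂ E).restrictScalars ℝ : E →L[ℝ] E)

/-- Vector fields on `M` (no regularity required). -/
abbrev VField (E : Type*) [NormedAddCommGroup E] [NormedSpace ℂ E]
    (M : Type*) [TopologicalSpace M] [ChartedSpace E M] : Type _ :=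
  Π x : M, TangentSpace 𝓘(ℝ, E) x

/-- Real functions of two tangent vectors at a point of `M`; used for 2-forms and metrics. -/
abbrev BilinField (E : Type*) [NormedAddCommGroup E] [NormedSpace ℂ E]
    (M : Type*) [TopologicalSpace M] [ChartedSpace E M] : Type _ :=
  Π x : M, TangentSpace 𝓘(ℝ, E) x → TangentSpace 𝓘(ℝ, E) x → ℝ

variable [IsManifold 𝓘(ℂ, E) ω M]

/-- The vector field `X` is differentiable at `x`, as a map into the tangent bundle. -/
def DiffAt (X : VField E M) (x : M) : Prop :=
  MDifferentiableAt 𝓘(ℝ, E) 𝓘(ℝ, E).tangent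
    (fun y => (⟨y, X y⟩ : TangentBundle 𝓘(ℝ, E) M)) x

/-- `cov` is the Levi-Civita connection of `h` on the set `U`: a covariant derivative (in the
convention `cov Y x (X x) = (∇_X Y)(x)`) that is metric and torsion free at the points of `U`. -/
structure IsLeviCivitaOn (h : BilinField E M)
    (cov : VField E M → Π x : M, TangentSpace 𝓘(ℝ, E) x →L[ℝ] TangentSpace 𝓘(ℝ, E) x)
    (U : Set M) : Prop where
  isCovariantDerivative : IsCovariantDerivativeOn E cov U
  metric : ∀ x ∈ U, ∀ Y Z : VField E M, DiffAt Y x → DiffAt Z x →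
    ∀ v : TangentSpace 𝓘(ℝ, E) x,
      mvfderiv 𝓘(ℝ, E) (fun y => h y (Y y) (Z y)) x v
        = h x (cov Y x v) (Z x) + h x (Y x) (cov Z x v)
  torsionFree : ∀ x ∈ U, ∀ X Y : VField E M, DiffAt X x → DiffAt Y x →
    cov Y x (X x) - cov X x (Y x) = VectorField.mlieBracket 𝓘(ℝ, E) X Y x

/-- The Hermitian metric `h` is a Kähler metric on the open set `U`: its Levi-Civita connection
satisfies `∇ J = 0`, that is `∇_v (J Y) = J (∇_v Y)`. -/
def IsKahlerOn (h : BilinField E M) (U : Set M) : Prop :=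
  ∃ cov : VField E M → Π x : M, TangentSpace 𝓘(ℝ, E) x →L[ℝ] TangentSpace 𝓘(ℝ, E) x,
    IsLeviCivitaOn h cov U ∧
    ∀ x ∈ U, ∀ Y : VField E M, DiffAt Y x → ∀ v : TangentSpace 𝓘(ℝ, E) x,
      cov (fun y => J y (Y y)) x v = J x (cov Y x v)

/-- The exterior derivative of a 1-form,
`dα(X, Y) = X α(Y) - Y α(X) - α([X, Y])`. -/
def dOne (α : Π x : M, TangentSpace 𝓘(ℝ, E) x →L[ℝ] ℝ) (X Y : VField E M) (x : M) : ℝ :=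
  mvfderiv 𝓘(ℝ, E) (fun y => α y (Y y)) x (X x)
    - mvfderiv 𝓘(ℝ, E) (fun y => α y (X y)) x (Y x)
    - α x (VectorField.mlieBracket 𝓘(ℝ, E) X Y x)

/-- The exterior derivative of a 2-form,
`dη(X, Y, Z) = X η(Y, Z) - Y η(X, Z) + Z η(X, Y) - η([X, Y], Z) + η([X, Z], Y) - η([Y, Z], X)`. -/
def dTwo (η : BilinField E M) (X Y Z : VField E M) (x : M) : ℝ :=
  mvfderiv 𝓘(ℝ, E) (fun y => η y (Y y) (Z y)) x (X x)
    - mvfderiv 𝓘(ℝ, E) (fun y => η y (X y) (Z y)) x (Y x)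
    + mvfderiv 𝓘(ℝ, E) (fun y => η y (X y) (Y y)) x (Z x)
    - η x (VectorField.mlieBracket 𝓘(ℝ, E) X Y x) (Z x)
    + η x (VectorField.mlieBracket 𝓘(ℝ, E) X Z x) (Y x)
    - η x (VectorField.mlieBracket 𝓘(ℝ, E) Y Z x) (X x)

/-- The wedge product of a 1-form and a 2-form,
`(α ∧ η)(X, Y, Z) = α(X) η(Y, Z) - α(Y) η(X, Z) + α(Z) η(X, Y)`. -/
def wedge (α : Π x : M, TangentSpace 𝓘(ℝ, E) x →L[ℝ] ℝ) (η : BilinField E M)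
    (X Y Z : VField E M) (x : M) : ℝ :=
  α x (X x) * η x (Y x) (Z x) - α x (Y x) * η x (X x) (Z x) + α x (Z x) * η x (X x) (Y x)

/-- Smooth Riemannian metrics on (the real manifold underlying) a complex manifold. -/
abbrev Metric (E : Type*) [NormedAddCommGroup E] [NormedSpace ℂ E]
    (M : Type*) [TopologicalSpace M] [ChartedSpace E M] [IsManifold 𝓘(ℂ, E) ω M] : Type _ :=
  ContMDiffRiemannianMetric 𝓘(ℝ, E) ∞ E (fun x : M => TangentSpace 𝓘(ℝ, E) x)

/-- The fundamental 2-form `Ω(v, w) = g(v, J w)`. -/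
def fundamentalForm (g : Metric E M) : BilinField E M :=
  fun x v w => g.inner x v (J x w)

/-- `(M, J, g)` is a locally conformal Kähler manifold: `g` is Hermitian, and every point has an
open neighbourhood `U` with a smooth function `u` on `U` such that `e^{-u} g` is a Kähler metric
on `U`. -/
structure IsLCK (g : Metric E M) : Prop where
  hermitian : ∀ (x : M) (v w : TangentSpace 𝓘(ℝ, E) x), g.inner x (J x v) (J x w) = g.inner x v w
  locallyConformal : ∀ x : M, ∃ U : Set M, IsOpen U ∧ x ∈ U ∧ ∃ u : M → ℝ,
    ContMDiffOn 𝓘(ℝ, E) 𝓘(ℝ, ℝ) ∞ u U ∧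
    IsKahlerOn (fun y v w => Real.exp (-u y) * g.inner y v w) U

/-- `α` is a Lee form of `(M, J, g)`: a smooth closed 1-form with `dΩ = α ∧ Ω`. -/
structure IsLeeForm (g : Metric E M) (α : Π x : M, TangentSpace 𝓘(ℝ, E) x →L[ℝ] ℝ) : Prop where
  smooth : ContMDiff 𝓘(ℝ, E) (𝓘(ℝ, E).prod 𝓘(ℝ, E →L[ℝ] ℝ)) ∞
    (fun x => TotalSpace.mk' (E →L[ℝ] ℝ) (E := fun x : M => TangentSpace 𝓘(ℝ, E) x →L[ℝ] ℝ)
      x (α x))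
  closed : ∀ (x : M) (X Y : VField E M), DiffAt X x → DiffAt Y x →
    dOne α X Y x = 0
  d_fundamentalForm : ∀ (x : M) (X Y Z : VField E M),
    DiffAt X x → DiffAt Y x → DiffAt Z x →
    dTwo (fundamentalForm g) X Y Z x = wedge α (fundamentalForm g) X Y Z x

/-- The inner product `g_x` as a bilinear form on `T_x M`. -/
def form (g : Metric E M) (x : M) : LinearMap.BilinForm ℝ (TangentSpace 𝓘(ℝ, E) x) :=
  (ContinuousLinearMap.coeLM ℝ).comp (g.inner x).toLinearMap

instance [FiniteDimensional ℂ E] (x : M) : FiniteDimensional ℝ (TangentSpace 𝓘(ℝ, E) x) :=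
  inferInstanceAs (FiniteDimensional ℝ E)

theorem form_nondegenerate (g : Metric E M) (x : M) : (form g x).Nondegenerate := by
  have key : ∀ v : TangentSpace 𝓘(ℝ, E) x, g.inner x v v = 0 → v = 0 := fun v hv => by
    by_contra hne
    exact (g.pos x v hne).ne' hv
  exact ⟨fun v hv => key v (hv v), fun v hv => key v (hv v)⟩

/-- The vector field `α^#` dual to the 1-form `α`: `g(α^#, v) = α(v)`. -/
def sharp [FiniteDimensional ℂ E] (g : Metric E M)
    (α : Π x : M, TangentSpace 𝓘(ℝ, E) x →L[ℝ] ℝ) : VField E M :=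
  fun x => ((form g x).toDual (form_nondegenerate g x)).symm (α x).toLinearMap

theorem inner_sharp [FiniteDimensional ℂ E] (g : Metric E M)
    (α : Π x : M, TangentSpace 𝓘(ℝ, E) x →L[ℝ] ℝ) (x : M) (v : TangentSpace 𝓘(ℝ, E) x) :
    g.inner x (sharp g α x) v = α x v :=
  LinearMap.BilinForm.apply_toDual_symm_apply (hB := form_nondegenerate g x)
    (α x).toLinearMap v

theorem isCompl_orthogonal [FiniteDimensional ℂ E] (g : Metric E M) (x : M)
    (S : Submodule ℝ (TangentSpace 𝓘(ℝ, E) x)) : IsCompl S ((form g x).orthogonal S) := by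
  have hrefl : (form g x).IsRefl := fun v w h => (g.symm x w v).trans h
  refine (LinearMap.BilinForm.isCompl_orthogonal_iff_disjoint hrefl).2 ?_
  rw [Submodule.disjoint_def]
  intro v hv hv'
  by_contra hne
  exact (g.pos x v hne).ne' (hv' v hv)

/-- The `g`-orthogonal projection of `T_x M` onto a subspace `S`. -/
def orthProj [FiniteDimensional ℂ E] (g : Metric E M) (x : M)
    (S : Submodule ℝ (TangentSpace 𝓘(ℝ, E) x)) :
    TangentSpace 𝓘(ℝ, E) x →ₗ[ℝ] TangentSpace 𝓘(ℝ, E) x :=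
  S.projection ((form g x).orthogonal S) (isCompl_orthogonal g x S)

end Ambient

/-! ## Warped products immersed in a complex manifold -/

section WarpedProduct

variable {E : Type*} [NormedAddCommGroup E] [NormedSpace ℂ E] [FiniteDimensional ℂ E]
  {M : Type*} [TopologicalSpace M] [ChartedSpace E M] [IsManifold 𝓘(ℂ, E) ω M]
  {E₁ : Type*} [NormedAddCommGroup E₁] [NormedSpace ℝ E₁]
  {N₁ : Type*} [TopologicalSpace N₁] [ChartedSpace E₁ N₁] [IsManifold 𝓘(ℝ, E₁) ∞ N₁]
  {E₂ : Type*} [NormedAddCommGroup E₂] [NormedSpace ℝ E₂]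
  {N₂ : Type*} [TopologicalSpace N₂] [ChartedSpace E₂ N₂] [IsManifold 𝓘(ℝ, E₂) ∞ N₂]

/-- The tangent space of the product manifold `N₁ × N₂` at `p`. -/
abbrev TProd (E₁ : Type*) [NormedAddCommGroup E₁] [NormedSpace ℝ E₁]
    (E₂ : Type*) [NormedAddCommGroup E₂] [NormedSpace ℝ E₂]
    {N₁ : Type*} [TopologicalSpace N₁] [ChartedSpace E₁ N₁]
    {N₂ : Type*} [TopologicalSpace N₂] [ChartedSpace E₂ N₂] (p : N₁ × N₂) : Type _ :=
  TangentSpace (𝓘(ℝ, E₁).prod 𝓘(ℝ, E₂)) p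

/-- The tangent map of the projection `π₁ : N₁ × N₂ → N₁`. -/
def dfst (p : N₁ × N₂) : TProd E₁ E₂ p →L[ℝ] TangentSpace 𝓘(ℝ, E₁) p.1 :=
  mfderiv (𝓘(ℝ, E₁).prod 𝓘(ℝ, E₂)) 𝓘(ℝ, E₁) (Prod.fst : N₁ × N₂ → N₁) p

/-- The tangent map of the projection `π₂ : N₁ × N₂ → N₂`. -/
def dsnd (p : N₁ × N₂) : TProd E₁ E₂ p →L[ℝ] TangentSpace 𝓘(ℝ, E₂) p.2 :=
  mfderiv (𝓘(ℝ, E₁).prod 𝓘(ℝ, E₂)) 𝓘(ℝ, E₂) (Prod.snd : N₁ × N₂ → N₂) p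

/-- The tangent spaces of the first factor, as a distribution on `N₁ × N₂`. -/
def factor₁ (p : N₁ × N₂) : Submodule ℝ (TProd E₁ E₂ p) := LinearMap.ker (dsnd p).toLinearMap

/-- The tangent spaces of the second factor, as a distribution on `N₁ × N₂`. -/
def factor₂ (p : N₁ × N₂) : Submodule ℝ (TProd E₁ E₂ p) := LinearMap.ker (dfst p).toLinearMap

/-- The warped product metric `g₁(π₁_* v, π₁_* w) + f(π₁ p)² g₂(π₂_* v, π₂_* w)`. -/
def warpedInner
    (g₁ : ContMDiffRiemannianMetric 𝓘(ℝ, E₁) ∞ E₁ (fun x : N₁ => TangentSpace 𝓘(ℝ, E₁) x))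
    (g₂ : ContMDiffRiemannianMetric 𝓘(ℝ, E₂) ∞ E₂ (fun x : N₂ => TangentSpace 𝓘(ℝ, E₂) x))
    (f : N₁ → ℝ) (p : N₁ × N₂) (v w : TProd E₁ E₂ p) : ℝ :=
  g₁.inner p.1 (dfst p v) (dfst p w) + f p.1 ^ 2 * g₂.inner p.2 (dsnd p v) (dsnd p w)

/-- The differential of a map `φ : N₁ × N₂ → M` into a complex manifold. -/
def dmap (E E₁ E₂ : Type*) [NormedAddCommGroup E] [NormedSpace ℂ E]
    [NormedAddCommGroup E₁] [NormedSpace ℝ E₁] [NormedAddCommGroup E₂] [NormedSpace ℝ E₂]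
    {M : Type*} [TopologicalSpace M] [ChartedSpace E M]
    {N₁ : Type*} [TopologicalSpace N₁] [ChartedSpace E₁ N₁]
    {N₂ : Type*} [TopologicalSpace N₂] [ChartedSpace E₂ N₂] (φ : N₁ × N₂ → M) (p : N₁ × N₂) : TProd E₁ E₂ p →L[ℝ] TangentSpace 𝓘(ℝ, E) (φ p) :=
  mfderiv (𝓘(ℝ, E₁).prod 𝓘(ℝ, E₂)) 𝓘(ℝ, E) φ p

/-- The tangential part `P v` of `J v`, for a vector `v` of the ambient space at `φ p`. -/
def tangentialJ (E₁ E₂ : Type*) [NormedAddCommGroup E₁] [NormedSpace ℝ E₁]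
    [NormedAddCommGroup E₂] [NormedSpace ℝ E₂]
    {N₁ : Type*} [TopologicalSpace N₁] [ChartedSpace E₁ N₁]
    {N₂ : Type*} [TopologicalSpace N₂] [ChartedSpace E₂ N₂]
    (g : Metric E M) (φ : N₁ × N₂ → M) (p : N₁ × N₂)
    (v : TangentSpace 𝓘(ℝ, E) (φ p)) : TangentSpace 𝓘(ℝ, E) (φ p) :=
  orthProj g (φ p) (LinearMap.range (dmap E E₁ E₂ φ p).toLinearMap) (J (φ p) v)

/-- `φ` immerses the warped product `N₁ ×_f N₂` isometrically in `(M, J, g)` as a pointwise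
semi-slant warped product with slant function `θ`: the distribution `𝔇` tangent to `N₁` is
holomorphic, `J 𝔇 = 𝔇`, and the distribution `𝔇^θ` tangent to `N₂` is pointwise slant,
`P² = -(cos² θ) I` on `𝔇^θ`. (That `𝔇` and `𝔇^θ` are orthogonal and span the tangent bundle is
automatic for a warped product.) -/
structure IsPointwiseSemiSlantWarpedProduct (g : Metric E M)
    (g₁ : ContMDiffRiemannianMetric 𝓘(ℝ, E₁) ∞ E₁ (fun x : N₁ => TangentSpace 𝓘(ℝ, E₁) x))
    (g₂ : ContMDiffRiemannianMetric 𝓘(ℝ, E₂) ∞ E₂ (fun x : N₂ => TangentSpace 𝓘(ℝ, E₂) x))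
    (f : N₁ → ℝ) (φ : N₁ × N₂ → M) (θ : N₁ × N₂ → ℝ) : Prop where
  warping_smooth : ContMDiff 𝓘(ℝ, E₁) 𝓘(ℝ, ℝ) ∞ f
  warping_pos : ∀ x, 0 < f x
  smooth : ContMDiff (𝓘(ℝ, E₁).prod 𝓘(ℝ, E₂)) 𝓘(ℝ, E) ∞ φ
  isometric : ∀ (p : N₁ × N₂) (v w : TProd E₁ E₂ p),
    g.inner (φ p) (dmap E E₁ E₂ φ p v) (dmap E E₁ E₂ φ p w) = warpedInner g₁ g₂ f p v w
  holomorphic : ∀ p : N₁ × N₂,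
    ((factor₁ p : Submodule ℝ (TProd E₁ E₂ p)).map (dmap E E₁ E₂ φ p).toLinearMap).map
        (J (φ p)).toLinearMap
      = (factor₁ p : Submodule ℝ (TProd E₁ E₂ p)).map (dmap E E₁ E₂ φ p).toLinearMap
  slant : ∀ (p : N₁ × N₂), ∀ Z ∈ (factor₂ p : Submodule ℝ (TProd E₁ E₂ p)),
    tangentialJ E₁ E₂ g φ p (tangentialJ E₁ E₂ g φ p (dmap E E₁ E₂ φ p Z))
      = -(Real.cos (θ p) ^ 2) • dmap E E₁ E₂ φ p Z

end WarpedProduct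

end LCK

end

/-! Fix a point, a vertical vector `Z` (tangent to the second factor) and a nonzero horizontal
vector `X` (tangent to the first). Since `J 𝔇 = 𝔇`, the vector `J X` is horizontal too. In a product
chart, extend `X`, `J X`, `Z` by fields `a`, `b`, `c` with constant coordinates, and evaluate the
pullback of `dΩ = α ∧ Ω` on `(b, a, c)`. The brackets vanish, and so does `Ω` on every
horizontal-vertical pair, because `𝔇` is `J`-stable and orthogonal to `𝔇^θ`. What survives at the
point is `c · Ω(b, a) = α(Z) |X|²`.

The left side is zero. The warped metric on horizontal vectors depends only on the first factor, so
`|a|` and `|b|` are constant along the `c`-line. By `fundamentalForm_le`, `2 Ω(b, a) ≤ |a|² + |b|²`,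
with equality at the point, where `b = J a`. Hence `Ω(b, a)` has a local maximum there along the
`c`-line. Nothing need be known about how `J` on `𝔇` varies along the second factor.

`d_pullbackForm` transfers the Lee identity to coordinates, `leeForm_eq_zero` is the maximum
argument, and `leeForm_dmap_factor₂` applies it to the immersion. -/

noncomputable section

namespace LCK

/-! ### Pullback and exterior derivative of 2-forms on normed spaces -/

section Calculus

variable {V : Type*} [NormedAddCommGroup V] [NormedSpace ℝ V]
  {E : Type*} [NormedAddCommGroup E] [NormedSpace ℝ E]

set_option synthInstance.maxHeartbeats 200000 in
/-- The derivative of the pullback of a field of bilinear forms. -/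
theorem fderiv_bilinear_pullback {Φ : V → E} {z : V} (hΦ : ContDiffAt ℝ 2 Φ z)
    {B : E → E →L[ℝ] E →L[ℝ] ℝ} (hB : DifferentiableAt ℝ B (Φ z)) (a b c : V) :
    fderiv ℝ (fun x => B (Φ x) (fderiv ℝ Φ x a) (fderiv ℝ Φ x b)) z c
      = fderiv ℝ B (Φ z) (fderiv ℝ Φ z c) (fderiv ℝ Φ z a) (fderiv ℝ Φ z b)
        + B (Φ z) (fderiv ℝ (fderiv ℝ Φ) z c a) (fderiv ℝ Φ z b)
        + B (Φ z) (fderiv ℝ Φ z a) (fderiv ℝ (fderiv ℝ Φ) z c b) := by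
  have h1 : HasFDerivAt Φ (fderiv ℝ Φ z) z :=
    (hΦ.differentiableAt two_ne_zero).hasFDerivAt
  have h2 : HasFDerivAt (fderiv ℝ Φ) (fderiv ℝ (fderiv ℝ Φ) z) z :=
    ((hΦ.fderiv_right (m := 1) (by norm_num)).differentiableAt one_ne_zero).hasFDerivAt
  have ha := h2.clm_apply (hasFDerivAt_const a z)
  have hb := h2.clm_apply (hasFDerivAt_const b z)
  have h0 : HasFDerivAt (fun x => B (Φ x)) ((fderiv ℝ B (Φ z)).comp (fderiv ℝ Φ z)) z :=
    HasFDerivAt.comp (g := B) z hB.hasFDerivAt h1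
  have h3 := h0.clm_apply ha
  have h := h3.clm_apply hb
  rw [HasFDerivAt.fderiv h]
  simp
  ring

/-- Exterior differentiation of 2-forms commutes with pullback, in coordinates. -/
theorem dTwo_pullback_coord {Φ : V → E} {z : V} (hΦ : ContDiffAt ℝ 2 Φ z)
    {B : E → E →L[ℝ] E →L[ℝ] ℝ} (hB : DifferentiableAt ℝ B (Φ z))
    (hanti : ∀ u v, B (Φ z) u v = - B (Φ z) v u) (a b c : V) :
    fderiv ℝ (fun x => B (Φ x) (fderiv ℝ Φ x b) (fderiv ℝ Φ x c)) z a
      - fderiv ℝ (fun x => B (Φ x) (fderiv ℝ Φ x a) (fderiv ℝ Φ x c)) z b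
      + fderiv ℝ (fun x => B (Φ x) (fderiv ℝ Φ x a) (fderiv ℝ Φ x b)) z c
    = fderiv ℝ B (Φ z) (fderiv ℝ Φ z a) (fderiv ℝ Φ z b) (fderiv ℝ Φ z c)
      - fderiv ℝ B (Φ z) (fderiv ℝ Φ z b) (fderiv ℝ Φ z a) (fderiv ℝ Φ z c)
      + fderiv ℝ B (Φ z) (fderiv ℝ Φ z c) (fderiv ℝ Φ z a) (fderiv ℝ Φ z b) := by
  have hs : IsSymmSndFDerivAt ℝ Φ z := hΦ.isSymmSndFDerivAt (by simp)
  rw [fderiv_bilinear_pullback hΦ hB, fderiv_bilinear_pullback hΦ hB,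
    fderiv_bilinear_pullback hΦ hB, hs.eq a b, hs.eq a c, hs.eq b c]
  -- By symmetry of the second derivative its terms occur in pairs; the pair with `D²Φ(c, a)` has
  -- its arguments in opposite slots and cancels by antisymmetry.
  rw [hanti (fderiv ℝ Φ z a) (fderiv ℝ (fderiv ℝ Φ) z c b),
    hanti (fderiv ℝ Φ z b) (fderiv ℝ (fderiv ℝ Φ) z c a)]
  ring

end Calculus

/-! ### The complex structure and the fundamental form in a holomorphic chart -/

section Chart

variable {E : Type*} [NormedAddCommGroup E] [NormedSpace ℂ E]
  {M : Type*} [TopologicalSpace M] [ChartedSpace E M]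

/-- The differential at `y` of the chart at `q`, with values in the model space. -/
def chartDeriv (q y : M) : TangentSpace 𝓘(ℝ, E) y →L[ℝ] E :=
  mfderiv 𝓘(ℝ, E) 𝓘(ℝ, E) (extChartAt 𝓘(ℝ, E) q) y

/-- The identification of the model space with the tangent space at `y` given by the chart at `q`;
it is zero if `y` is outside the domain of this chart. -/
def chartFrame (q y : M) : E →L[ℝ] TangentSpace 𝓘(ℝ, E) y :=
  (chartDeriv q y).inverse

/-- The vector field with constant coordinates `u` in the chart at `q`. -/
def chartField (q : M) (u : E) : VField E M := fun y => chartFrame q y u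

theorem J_J (y : M) (v : TangentSpace 𝓘(ℝ, E) y) : J y (J y v) = -v := by
  have h : ∀ w : E, Complex.I • Complex.I • w = -w := fun w => by
    rw [smul_smul, Complex.I_mul_I, neg_one_smul]
  exact h v

variable [IsManifold 𝓘(ℂ, E) ω M]

theorem isInvertible_chartDeriv {q y : M} (hy : y ∈ (chartAt E q).source) :
    (chartDeriv q y : TangentSpace 𝓘(ℝ, E) y →L[ℝ] E).IsInvertible := by
  have : IsManifold 𝓘(ℝ, E) 1 M := IsManifold.of_le (n := ∞) (by simp)
  exact isInvertible_mfderiv_extChartAt (by simpa using hy)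

theorem chartDeriv_chartFrame {q y : M} (hy : y ∈ (chartAt E q).source) (u : E) :
    chartDeriv q y (chartFrame q y u) = u :=
  (isInvertible_chartDeriv hy).self_apply_inverse u

theorem chartFrame_chartDeriv {q y : M} (hy : y ∈ (chartAt E q).source)
    (v : TangentSpace 𝓘(ℝ, E) y) : chartFrame q y (chartDeriv q y v) = v :=
  (isInvertible_chartDeriv hy).inverse_apply_self v

/-- The tangent space at `q` is by definition read in the preferred chart at `q`, so that chart has
identity differential there. -/
theorem chartFrame_self (q : M) (u : E) : chartFrame q q u = u := by
  have : IsManifold 𝓘(ℝ, E) 1 M := IsManifold.of_le (n := ∞) (by simp)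
  have h : chartDeriv q q = ContinuousLinearMap.id ℝ E :=
    mfderiv_extChartAt_self (I := 𝓘(ℝ, E)) (x := q)
  have h' : chartDeriv q q u = u := congrArg (fun L : E →L[ℝ] E => L u) h
  exact (congrArg (chartFrame q q) h').symm.trans
    (chartFrame_chartDeriv (mem_chart_source E q) (u :))

/-- The differential of a chart is complex linear. -/
theorem chartDeriv_J {q y : M} (hy : y ∈ (chartAt E q).source)
    (v : TangentSpace 𝓘(ℝ, E) y) : chartDeriv q y (J y v) = Complex.I • chartDeriv q y v := by
  have : IsManifold 𝓘(ℂ, E) 1 M := IsManifold.of_le (n := ω) (by simp)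
  -- The chart is complex differentiable; restricting scalars in its complex derivative gives the
  -- real one, by uniqueness of derivatives.
  obtain ⟨hc, hd⟩ := (mdifferentiableAt_extChartAt (I := 𝓘(ℂ, E)) hy).hasMFDerivAt
  let L : E →L[ℂ] E := mfderiv 𝓘(ℂ, E) 𝓘(ℂ, E) (extChartAt 𝓘(ℂ, E) q) y
  have h : HasMFDerivAt 𝓘(ℝ, E) 𝓘(ℝ, E) (extChartAt 𝓘(ℝ, E) q) y (L.restrictScalars ℝ) :=
    ⟨hc, HasFDerivWithinAt.restrictScalars (𝕜 := ℝ) (f' := L) hd⟩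
  have h' : chartDeriv q y = L.restrictScalars ℝ := h.mfderiv
  rw [h']
  exact L.map_smul Complex.I v

/-- In coordinates `J` is the constant `i`, so the regularity of `Ω` reduces to that of `g`. -/
theorem J_chartFrame {q y : M} (hy : y ∈ (chartAt E q).source) (u : E) :
    J y (chartFrame q y u) = chartFrame q y (Complex.I • u) := by
  rw [← chartFrame_chartDeriv hy (J y (chartFrame q y u)), chartDeriv_J hy,
    chartDeriv_chartFrame hy]

/-- The constant vector field on a vector space. -/
def constField (u : E) (x : E) : TangentSpace 𝓘(ℝ, E) x := u

omit [IsManifold 𝓘(ℂ, E) ω M] in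
theorem mdifferentiableAt_constField (u e : E) :
    MDifferentiableAt 𝓘(ℝ, E) 𝓘(ℝ, E).tangent
      (fun x => (⟨x, constField u x⟩ : TangentBundle 𝓘(ℝ, E) E)) e :=
  (contMDiffAt_vectorSpace_iff_contDiffAt (n := 1) (V := constField u)).2 contDiffAt_const
    |>.mdifferentiableAt one_ne_zero

theorem mlieBracket_constField (u v : E) :
    VectorField.mlieBracket 𝓘(ℝ, E) (constField u) (constField v) = 0 := by
  rw [← VectorField.mlieBracketWithin_univ, VectorField.mlieBracketWithin_eq_lieBracketWithin]
  have hc : ∀ w : E, fderivWithin ℝ (fun _ : E => w) univ = 0 := fun w => by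
    ext; simp
  funext x
  change fderivWithin ℝ (fun _ : E => v) univ x u - fderivWithin ℝ (fun _ : E => u) univ x v = 0
  simp [hc]

variable [FiniteDimensional ℂ E]

theorem diffAt_chartField (q : M) (u : E) : DiffAt (chartField q u) q := by
  have : CompleteSpace E := FiniteDimensional.complete ℂ E
  have : IsManifold 𝓘(ℝ, E) 2 M := IsManifold.of_le (n := ∞) (ENat.LEInfty.out)
  exact MDifferentiableAt.mpullback_vectorField (n := 2)
    (V := constField u) (f := extChartAt 𝓘(ℝ, E) q)
    (mdifferentiableAt_constField u _) contMDiffAt_extChartAt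
    (isInvertible_chartDeriv (mem_chart_source E q) :) le_rfl

/-- Brackets commute with pullback along the chart, and constant fields commute. This removes the
bracket terms of `dTwo`. -/
theorem mlieBracket_chartField (q : M) (u v : E) :
    VectorField.mlieBracket 𝓘(ℝ, E) (chartField q u) (chartField q v) q = 0 := by
  have : CompleteSpace E := FiniteDimensional.complete ℂ E
  have : IsManifold 𝓘(ℝ, E) 2 M := IsManifold.of_le (n := ∞) (ENat.LEInfty.out)
  have : IsManifold 𝓘(ℝ, E) (minSmoothness ℝ 2) M := by simpa
  have := VectorField.mpullback_mlieBracket (n := 2) (I := 𝓘(ℝ, E)) (I' := 𝓘(ℝ, E))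
    (f := extChartAt 𝓘(ℝ, E) q) (V := constField u) (W := constField v) (x₀ := q)
    (mdifferentiableAt_constField u _) (mdifferentiableAt_constField v _)
    contMDiffAt_extChartAt (by simp)
  refine this.symm.trans ?_
  rw [mlieBracket_constField, VectorField.mpullback_zero]
  rfl

/-- The fundamental form in the chart at `q`, as a function of the coordinates. -/
def chartForm (g : Metric E M) (q : M) (e : E) : E →L[ℝ] E →L[ℝ] ℝ :=
  let y := (extChartAt 𝓘(ℝ, E) q).symm e
  let G : E →L[ℝ] E →L[ℝ] ℝ := g.inner y
  let A : E →L[ℝ] E := chartFrame q y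
  G.bilinearComp A ((J y).comp A)

omit [FiniteDimensional ℂ E] in
theorem chartForm_apply (g : Metric E M) (q : M) (e u v : E) :
    chartForm g q e u v = fundamentalForm g ((extChartAt 𝓘(ℝ, E) q).symm e)
      (chartField q u _) (chartField q v _) := rfl

omit [FiniteDimensional ℂ E] in
theorem chartForm_extChartAt (g : Metric E M) {q y : M} (hy : y ∈ (chartAt E q).source) (u v : E) :
    chartForm g q (extChartAt 𝓘(ℝ, E) q y) u v
      = fundamentalForm g y (chartField q u y) (chartField q v y) := by
  rw [chartForm_apply, (extChartAt 𝓘(ℝ, E) q).left_inv (by simpa using hy)]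

theorem mdifferentiableAt_fundamentalForm_chartField (g : Metric E M) (q : M) (u v : E) :
    MDifferentiableAt 𝓘(ℝ, E) 𝓘(ℝ, ℝ)
      (fun y => fundamentalForm g y (chartField q u y) (chartField q v y)) q := by
  have h : MDifferentiableAt 𝓘(ℝ, E) 𝓘(ℝ, ℝ)
      (fun y => g.inner y (chartField q u y) (chartField q (Complex.I • v) y)) q := by
    have h1 := (g.contMDiff q).mdifferentiableAt (by simp)
    have h2 := MDifferentiableAt.clm_bundle_apply₂ (F₃ := ℝ) (E₃ := Bundle.Trivial M ℝ) h1
      (diffAt_chartField q u) (diffAt_chartField q (Complex.I • v))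
    exact (mdifferentiableAt_section 𝓘(ℝ, E) (F := ℝ) (E := Bundle.Trivial M ℝ) _).1 h2
  refine h.congr_of_eventuallyEq ?_
  filter_upwards [(chartAt E q).open_source.mem_nhds (mem_chart_source E q)] with y hy
  exact congrArg (g.inner y (chartField q u y)) (J_chartFrame hy v)

/-- As `F` is finite-dimensional, a linear map out of it amounts to its values on a basis, and
differentiability can be tested on these. -/
theorem differentiableAt_clm_of_apply {G F F' : Type*} [NormedAddCommGroup G] [NormedSpace ℝ G]
    [NormedAddCommGroup F] [NormedSpace ℝ F] [FiniteDimensional ℝ F]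
    [NormedAddCommGroup F'] [NormedSpace ℝ F'] {f : G → F →L[ℝ] F'} {x : G}
    (h : ∀ u, DifferentiableAt ℝ (fun y => f y u) x) : DifferentiableAt ℝ f x := by
  let d := Module.finrank ℝ F
  have hd : d = Module.finrank ℝ (Fin d → ℝ) := (Module.finrank_fin_fun ℝ).symm
  let e₁ := ContinuousLinearEquiv.ofFinrankEq hd
  let e₂ := (e₁.arrowCongr (1 : F' ≃L[ℝ] F')).trans (ContinuousLinearEquiv.piRing (Fin d))
  rw [← Function.id_comp f, ← e₂.symm_comp_self]
  exact e₂.symm.differentiableAt.comp x (differentiableAt_pi.mpr fun i => h _)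

theorem differentiableAt_chartForm (g : Metric E M) (q : M) :
    DifferentiableAt ℝ (chartForm g q) (extChartAt 𝓘(ℝ, E) q q) := by
  refine differentiableAt_clm_of_apply fun u => differentiableAt_clm_of_apply fun v => ?_
  have hs : MDifferentiableAt 𝓘(ℝ, E) 𝓘(ℝ, E) (extChartAt 𝓘(ℝ, E) q).symm
      (extChartAt 𝓘(ℝ, E) q q) :=
    ((contMDiffOn_extChartAt_symm (n := ∞) q).contMDiffAt
      (extChartAt_target_mem_nhds q)).mdifferentiableAt (by simp)
  have hf := mdifferentiableAt_fundamentalForm_chartField g q u v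
  have hf' : MDifferentiableAt 𝓘(ℝ, E) 𝓘(ℝ, ℝ)
      (fun y => fundamentalForm g y (chartField q u y) (chartField q v y))
      ((extChartAt 𝓘(ℝ, E) q).symm (extChartAt 𝓘(ℝ, E) q q)) := by
    rwa [extChartAt_to_inv]
  exact (hf'.comp _ hs).differentiableAt

theorem mvfderiv_fundamentalForm_chartField (g : Metric E M) (q : M) (u v w : E) :
    mvfderiv 𝓘(ℝ, E) (fun y => fundamentalForm g y (chartField q u y) (chartField q v y)) q
        (chartField q w q)
      = fderiv ℝ (chartForm g q) (extChartAt 𝓘(ℝ, E) q q) w u v := by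
  have h1 := (mdifferentiableAt_fundamentalForm_chartField g q u v).mvfderiv
  have h2 : fderiv ℝ (fun e => chartForm g q e u v) (extChartAt 𝓘(ℝ, E) q q) w
      = fderiv ℝ (chartForm g q) (extChartAt 𝓘(ℝ, E) q q) w u v := by
    have hB := (differentiableAt_chartForm g q).hasFDerivAt
    have hBu := hB.clm_apply (hasFDerivAt_const u _)
    have hBv := hBu.clm_apply (hasFDerivAt_const v _)
    rw [HasFDerivAt.fderiv hBv]
    simp
  rw [h1, ← h2, ← fderivWithin_univ, chartField, chartFrame_self]
  simp only [mfld_simps]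
  rfl

theorem dTwo_chartField (g : Metric E M) (q : M) (u v w : E) :
    dTwo (fundamentalForm g) (chartField q u) (chartField q v) (chartField q w) q
      = fderiv ℝ (chartForm g q) (extChartAt 𝓘(ℝ, E) q q) u v w
        - fderiv ℝ (chartForm g q) (extChartAt 𝓘(ℝ, E) q q) v u w
        + fderiv ℝ (chartForm g q) (extChartAt 𝓘(ℝ, E) q q) w u v := by
  have h0 : ∀ z, fundamentalForm g q 0 z = 0 := fun z => by simp [fundamentalForm]
  rw [dTwo, mvfderiv_fundamentalForm_chartField, mvfderiv_fundamentalForm_chartField,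
    mvfderiv_fundamentalForm_chartField, mlieBracket_chartField, mlieBracket_chartField,
    mlieBracket_chartField, h0, h0, h0]
  ring

end Chart

/-! ### The Lee identity pulled back, and the maximum argument -/

section Pullback

variable {E : Type*} [NormedAddCommGroup E] [NormedSpace ℂ E] [FiniteDimensional ℂ E]
  {M : Type*} [TopologicalSpace M] [ChartedSpace E M] [IsManifold 𝓘(ℂ, E) ω M]
  {V : Type*} [NormedAddCommGroup V] [NormedSpace ℝ V]

/-- The pullback of the fundamental form along `F`, evaluated on constant vector fields. -/
def pullbackForm (g : Metric E M) (F : V → M) (a b x : V) : ℝ :=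
  fundamentalForm g (F x) (mfderiv 𝓘(ℝ, V) 𝓘(ℝ, E) F x a) (mfderiv 𝓘(ℝ, V) 𝓘(ℝ, E) F x b)

omit [FiniteDimensional ℂ E] in
theorem inner_J_left (g : Metric E M) (hg : IsLCK g) (x : M) (v w : TangentSpace 𝓘(ℝ, E) x) :
    g.inner x (J x v) w = -g.inner x v (J x w) := by
  rw [← hg.hermitian x v (J x w), J_J, map_neg, neg_neg]

omit [FiniteDimensional ℂ E] in
theorem fundamentalForm_antisymm (g : Metric E M) (hg : IsLCK g) (x : M)
    (v w : TangentSpace 𝓘(ℝ, E) x) :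
    fundamentalForm g x v w = -fundamentalForm g x w v := by
  rw [fundamentalForm, fundamentalForm, ← inner_J_left g hg, g.symm]

-- Expand `|v - J w|² ≥ 0` and use `|J w| = |w|`. Equality holds when `v = J w`.
omit [FiniteDimensional ℂ E] in
theorem fundamentalForm_le (g : Metric E M) (hg : IsLCK g) (x : M)
    (v w : TangentSpace 𝓘(ℝ, E) x) :
    2 * fundamentalForm g x v w ≤ g.inner x v v + g.inner x w w := by
  have h : 0 ≤ g.inner x (v - J x w) (v - J x w) := by
    by_cases h : v - J x w = 0
    · rw [h]; simp
    · exact (g.pos _ _ h).le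
  rw [map_sub, map_sub, sub_apply, sub_apply, hg.hermitian, g.symm x (J x w) v] at h
  rw [fundamentalForm]
  linarith

omit [FiniteDimensional ℂ E] in
theorem mfderiv_eq_chartFrame_fderiv {F : V → M} {q : M} {x : V}
    (hF : MDifferentiableAt 𝓘(ℝ, V) 𝓘(ℝ, E) F x) (hx : F x ∈ (chartAt E q).source) (a : V) :
    mfderiv 𝓘(ℝ, V) 𝓘(ℝ, E) F x a
      = chartField q (fderiv ℝ (fun y => extChartAt 𝓘(ℝ, E) q (F y)) x a) (F x) := by
  have : IsManifold 𝓘(ℝ, E) 1 M := IsManifold.of_le (n := ∞) (by simp)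
  have h := mfderiv_comp_apply x
    (mdifferentiableAt_extChartAt (I := 𝓘(ℝ, E)) hx) hF a
  have h' : fderiv ℝ (fun y => extChartAt 𝓘(ℝ, E) q (F y)) x a
      = chartDeriv q (F x) (mfderiv 𝓘(ℝ, V) 𝓘(ℝ, E) F x a) := by
    rw [← mfderiv_eq_fderiv]
    exact h
  rw [h', chartField, chartFrame_chartDeriv hx]

/-- The identity `dΩ = α ∧ Ω`, pulled back along a smooth map from a normed space. -/
theorem d_pullbackForm {g : Metric E M} (hg : IsLCK g)
    {α : Π x : M, TangentSpace 𝓘(ℝ, E) x →L[ℝ] ℝ} (hα : IsLeeForm g α)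
    {F : V → M} {z : V} (hF : ContMDiffAt 𝓘(ℝ, V) 𝓘(ℝ, E) 2 F z) (a b c : V) :
    fderiv ℝ (pullbackForm g F b c) z a - fderiv ℝ (pullbackForm g F a c) z b
        + fderiv ℝ (pullbackForm g F a b) z c
      = α (F z) (mfderiv 𝓘(ℝ, V) 𝓘(ℝ, E) F z a) * pullbackForm g F b c z
        - α (F z) (mfderiv 𝓘(ℝ, V) 𝓘(ℝ, E) F z b) * pullbackForm g F a c z
        + α (F z) (mfderiv 𝓘(ℝ, V) 𝓘(ℝ, E) F z c) * pullbackForm g F a b z := by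
  have : IsManifold 𝓘(ℝ, E) 2 M := IsManifold.of_le (n := ∞) (ENat.LEInfty.out)
  set q := F z with hq
  set Φ : V → E := fun y => extChartAt 𝓘(ℝ, E) q (F y) with hΦdef
  have hsrc : ∀ᶠ x in 𝓝 z, F x ∈ (chartAt E q).source :=
    hF.continuousAt.preimage_mem_nhds ((chartAt E q).open_source.mem_nhds (mem_chart_source E q))
  have hdiff : ∀ᶠ x in 𝓝 z, MDifferentiableAt 𝓘(ℝ, V) 𝓘(ℝ, E) F x := by
    filter_upwards [(contMDiffAt_iff_contMDiffAt_nhds (by simp)).1 hF] with x hx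
    exact hx.mdifferentiableAt two_ne_zero
  have hΦ : ContDiffAt ℝ 2 Φ z :=
    ((contMDiffAt_extChartAt (I := 𝓘(ℝ, E)) (n := 2) (x := q)).comp z hF).contDiffAt
  have hcoord : ∀ᶠ x in 𝓝 z, ∀ u v, pullbackForm g F u v x
      = chartForm g q (Φ x) (fderiv ℝ Φ x u) (fderiv ℝ Φ x v) := by
    filter_upwards [hsrc, hdiff] with x hx hx' u v
    rw [hΦdef, chartForm_extChartAt g hx, pullbackForm, mfderiv_eq_chartFrame_fderiv hx' hx,
      mfderiv_eq_chartFrame_fderiv hx' hx]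
  have hfd : ∀ u v, fderiv ℝ (pullbackForm g F u v) z
      = fderiv ℝ (fun x => chartForm g q (Φ x) (fderiv ℝ Φ x u) (fderiv ℝ Φ x v)) z := fun u v =>
    Filter.EventuallyEq.fderiv_eq (hcoord.mono fun x hx => hx u v)
  have hanti : ∀ u v, chartForm g q (Φ z) u v = -chartForm g q (Φ z) v u := fun u v => by
    rw [chartForm_apply, chartForm_apply, fundamentalForm_antisymm g hg]
  have hmf : ∀ u, mfderiv 𝓘(ℝ, V) 𝓘(ℝ, E) F z u = chartField q (fderiv ℝ Φ z u) q := fun u =>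
    mfderiv_eq_chartFrame_fderiv hdiff.self_of_nhds hsrc.self_of_nhds u
  rw [hfd, hfd, hfd, dTwo_pullback_coord hΦ (differentiableAt_chartForm g q) hanti]
  -- The Lee identity is applied to the chart fields through the three image vectors. They extend
  -- these vectors to fields on `M` even though `F` need not be an embedding.
  have hL := hα.d_fundamentalForm q _ _ _ (diffAt_chartField q (fderiv ℝ Φ z a))
    (diffAt_chartField q (fderiv ℝ Φ z b)) (diffAt_chartField q (fderiv ℝ Φ z c))
  rw [dTwo_chartField, wedge] at hL
  rw [← hmf a, ← hmf b, ← hmf c] at hL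
  exact hL

/-- If the metric pulled back along `F` is constant in the direction `c` on two vectors `a` and `b`
that are `Ω`-orthogonal to `c`, and `J` maps one to the other at `z`, then the Lee form vanishes
on the image of `c` at `z`. -/
theorem leeForm_eq_zero {g : Metric E M} (hg : IsLCK g)
    {α : Π x : M, TangentSpace 𝓘(ℝ, E) x →L[ℝ] ℝ} (hα : IsLeeForm g α)
    {F : V → M} {z : V} (hF : ContMDiffAt 𝓘(ℝ, V) 𝓘(ℝ, E) 2 F z) {a b c : V}
    (hac : ∀ᶠ x in 𝓝 z, pullbackForm g F a c x = 0)
    (hbc : ∀ᶠ x in 𝓝 z, pullbackForm g F b c x = 0)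
    {k l : ℝ}
    (ha : ∀ᶠ t : ℝ in 𝓝 0, g.inner (F (z + t • c)) (mfderiv 𝓘(ℝ, V) 𝓘(ℝ, E) F (z + t • c) a)
      (mfderiv 𝓘(ℝ, V) 𝓘(ℝ, E) F (z + t • c) a) = k)
    (hb : ∀ᶠ t : ℝ in 𝓝 0, g.inner (F (z + t • c)) (mfderiv 𝓘(ℝ, V) 𝓘(ℝ, E) F (z + t • c) b)
      (mfderiv 𝓘(ℝ, V) 𝓘(ℝ, E) F (z + t • c) b) = l)
    (hJ : mfderiv 𝓘(ℝ, V) 𝓘(ℝ, E) F z b = J (F z) (mfderiv 𝓘(ℝ, V) 𝓘(ℝ, E) F z a))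
    (hne : mfderiv 𝓘(ℝ, V) 𝓘(ℝ, E) F z a ≠ 0) :
    α (F z) (mfderiv 𝓘(ℝ, V) 𝓘(ℝ, E) F z c) = 0 := by
  have hpos := g.pos _ _ hne
  have hz : pullbackForm g F b a z
      = g.inner (F z) (mfderiv 𝓘(ℝ, V) 𝓘(ℝ, E) F z a) (mfderiv 𝓘(ℝ, V) 𝓘(ℝ, E) F z a) := by
    rw [pullbackForm, fundamentalForm, hJ, hg.hermitian]
  have hk := ha.self_of_nhds
  have hl := hb.self_of_nhds
  rw [zero_smul, add_zero] at hk hl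
  have hkl : l = k := by rw [← hl, ← hk, hJ, hg.hermitian]
  -- The bound `(k + l) / 2 = k` holds all along the line and is attained at `t = 0`, where `J` maps
  -- the image of `a` to that of `b`.
  have hmax : IsLocalMax (fun t : ℝ => pullbackForm g F b a (z + t • c)) 0 := by
    filter_upwards [ha, hb] with t hat hbt
    rw [zero_smul, add_zero, hz, hk]
    have h := fundamentalForm_le g hg (F (z + t • c)) (mfderiv 𝓘(ℝ, V) 𝓘(ℝ, E) F (z + t • c) b)
      (mfderiv 𝓘(ℝ, V) 𝓘(ℝ, E) F (z + t • c) a)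
    rw [hat, hbt, hkl] at h
    change fundamentalForm g _ _ _ ≤ k
    linarith
  have hd : fderiv ℝ (pullbackForm g F b a) z c = 0 := by
    -- Differentiability need not be proved: otherwise `fderiv` takes its default value `0`.
    by_cases h : DifferentiableAt ℝ (pullbackForm g F b a) z
    · have h1 : HasDerivAt (fun t : ℝ => z + t • c) c 0 := by
        simpa using ((hasDerivAt_id (0 : ℝ)).smul_const c).const_add z
      have h2 : HasFDerivAt (pullbackForm g F b a) (fderiv ℝ (pullbackForm g F b a) z)
          (z + (0 : ℝ) • c) := by simpa using h.hasFDerivAt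
      exact hmax.hasDerivAt_eq_zero (HasFDerivAt.comp_hasDerivAt (l := pullbackForm g F b a) 0 h2 h1)
    · rw [fderiv_zero_of_not_differentiableAt h]; rfl
  have hzero : ∀ u : V, (∀ᶠ x in 𝓝 z, pullbackForm g F u c x = 0) →
      fderiv ℝ (pullbackForm g F u c) z = 0 := fun u hu => by
    rw [Filter.EventuallyEq.fderiv_eq (f := fun _ => (0 : ℝ)) hu]
    simp
  -- In this order the only surviving term is `α(c) Ω(b, a)`, with `Ω(b, a) = |a|² > 0` at `z`.
  have h := d_pullbackForm hg hα hF b a c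
  rw [hzero a hac, hzero b hbc, hd, hac.self_of_nhds, hbc.self_of_nhds, hz] at h
  simp only [zero_apply, mul_zero, sub_zero, zero_add, add_zero] at h
  exact (mul_eq_zero.1 h.symm).resolve_right hpos.ne'

end Pullback

/-! ### Product charts and the two factor distributions -/

section ProductChart

variable {E₁ : Type*} [NormedAddCommGroup E₁] [NormedSpace ℝ E₁]
  {N₁ : Type*} [TopologicalSpace N₁] [ChartedSpace E₁ N₁] [IsManifold 𝓘(ℝ, E₁) ∞ N₁]
  {E₂ : Type*} [NormedAddCommGroup E₂] [NormedSpace ℝ E₂]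
  {N₂ : Type*} [TopologicalSpace N₂] [ChartedSpace E₂ N₂] [IsManifold 𝓘(ℝ, E₂) ∞ N₂]

/-- The inverse of the product chart at `p`. -/
def paramAt (p : N₁ × N₂) (x : E₁ × E₂) : N₁ × N₂ :=
  ((extChartAt 𝓘(ℝ, E₁) p.1).symm x.1, (extChartAt 𝓘(ℝ, E₂) p.2).symm x.2)

/-- The coordinates of `p` in the product chart at `p`. -/
def coordAt (E₁ E₂ : Type*) [NormedAddCommGroup E₁] [NormedSpace ℝ E₁]
    [NormedAddCommGroup E₂] [NormedSpace ℝ E₂]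
    {N₁ : Type*} [TopologicalSpace N₁] [ChartedSpace E₁ N₁]
    {N₂ : Type*} [TopologicalSpace N₂] [ChartedSpace E₂ N₂] (p : N₁ × N₂) : E₁ × E₂ :=
  (extChartAt 𝓘(ℝ, E₁) p.1 p.1, extChartAt 𝓘(ℝ, E₂) p.2 p.2)

/-- The differential of the inverse of the product chart at `p`. -/
def dparamAt (p : N₁ × N₂) (x : E₁ × E₂) : E₁ × E₂ →L[ℝ] TProd E₁ E₂ (paramAt p x) :=
  mfderiv 𝓘(ℝ, E₁ × E₂) (𝓘(ℝ, E₁).prod 𝓘(ℝ, E₂)) (paramAt p) x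

omit [IsManifold 𝓘(ℝ, E₁) ∞ N₁] [IsManifold 𝓘(ℝ, E₂) ∞ N₂] in
theorem paramAt_coordAt (p : N₁ × N₂) : paramAt p (coordAt E₁ E₂ p) = p := by
  simp [paramAt, coordAt]

theorem contMDiffAt_chart_symm {N : Type*} [TopologicalSpace N] [ChartedSpace E₁ N]
    [IsManifold 𝓘(ℝ, E₁) ∞ N] (q : N) {e : E₁} (he : e ∈ (extChartAt 𝓘(ℝ, E₁) q).target) :
    ContMDiffAt 𝓘(ℝ, E₁) 𝓘(ℝ, E₁) ∞ (extChartAt 𝓘(ℝ, E₁) q).symm e :=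
  (contMDiffOn_extChartAt_symm q).contMDiffAt ((isOpen_extChartAt_target q).mem_nhds he)

theorem bijective_mfderiv_chart_symm {N : Type*} [TopologicalSpace N] [ChartedSpace E₁ N]
    [IsManifold 𝓘(ℝ, E₁) ∞ N] (q : N) {e : E₁} (he : e ∈ (extChartAt 𝓘(ℝ, E₁) q).target) :
    Function.Bijective (mfderiv 𝓘(ℝ, E₁) 𝓘(ℝ, E₁) (extChartAt 𝓘(ℝ, E₁) q).symm e) := by
  have : IsManifold 𝓘(ℝ, E₁) 1 N := IsManifold.of_le (n := ∞) (by simp)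
  have h := isInvertible_mfderivWithin_extChartAt_symm (I := 𝓘(ℝ, E₁)) he
  rw [ModelWithCorners.range_eq_univ, mfderivWithin_univ] at h
  exact h.bijective

/-- The domain of the parametrization `paramAt p`. -/
def paramDomain (E₁ E₂ : Type*) [NormedAddCommGroup E₁] [NormedSpace ℝ E₁]
    [NormedAddCommGroup E₂] [NormedSpace ℝ E₂]
    {N₁ : Type*} [TopologicalSpace N₁] [ChartedSpace E₁ N₁]
    {N₂ : Type*} [TopologicalSpace N₂] [ChartedSpace E₂ N₂] (p : N₁ × N₂) : Set (E₁ × E₂) :=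
  (extChartAt 𝓘(ℝ, E₁) p.1).target ×ˢ (extChartAt 𝓘(ℝ, E₂) p.2).target

omit [IsManifold 𝓘(ℝ, E₁) ∞ N₁] [IsManifold 𝓘(ℝ, E₂) ∞ N₂] in
theorem isOpen_paramDomain (p : N₁ × N₂) : IsOpen (paramDomain E₁ E₂ p) :=
  (isOpen_extChartAt_target p.1).prod (isOpen_extChartAt_target p.2)

omit [IsManifold 𝓘(ℝ, E₁) ∞ N₁] [IsManifold 𝓘(ℝ, E₂) ∞ N₂] in
theorem coordAt_mem_paramDomain (p : N₁ × N₂) : coordAt E₁ E₂ p ∈ paramDomain E₁ E₂ p :=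
  ⟨mem_extChartAt_target p.1, mem_extChartAt_target p.2⟩

variable {p : N₁ × N₂} {x : E₁ × E₂}

theorem contMDiffAt_paramAt (hx : x ∈ paramDomain E₁ E₂ p) :
    ContMDiffAt 𝓘(ℝ, E₁ × E₂) (𝓘(ℝ, E₁).prod 𝓘(ℝ, E₂)) ∞ (paramAt p) x :=
  ((contMDiffAt_chart_symm p.1 hx.1).comp x contDiff_fst.contMDiff.contMDiffAt).prodMk
    ((contMDiffAt_chart_symm p.2 hx.2).comp x contDiff_snd.contMDiff.contMDiffAt)

theorem dfst_dparamAt (hx : x ∈ paramDomain E₁ E₂ p) (v : E₁ × E₂) :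
    dfst (paramAt p x) (dparamAt p x v)
      = mfderiv 𝓘(ℝ, E₁) 𝓘(ℝ, E₁) (extChartAt 𝓘(ℝ, E₁) p.1).symm x.1 v.1 := by
  have h := mfderiv_comp_apply x (g := (Prod.fst : N₁ × N₂ → N₁)) (I'' := 𝓘(ℝ, E₁))
    mdifferentiableAt_fst ((contMDiffAt_paramAt hx).mdifferentiableAt (by simp)) v
  have h' := mfderiv_comp_apply x (I := 𝓘(ℝ, E₁ × E₂)) (I' := 𝓘(ℝ, E₁))
    (f := (Prod.fst : E₁ × E₂ → E₁))
    ((contMDiffAt_chart_symm p.1 hx.1).mdifferentiableAt (by simp))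
    differentiableAt_fst.mdifferentiableAt v
  rw [mfderiv_eq_fderiv, fderiv_fst] at h'
  exact h.symm.trans h'

theorem dsnd_dparamAt (hx : x ∈ paramDomain E₁ E₂ p) (v : E₁ × E₂) :
    dsnd (paramAt p x) (dparamAt p x v)
      = mfderiv 𝓘(ℝ, E₂) 𝓘(ℝ, E₂) (extChartAt 𝓘(ℝ, E₂) p.2).symm x.2 v.2 := by
  have h := mfderiv_comp_apply x (g := (Prod.snd : N₁ × N₂ → N₂)) (I'' := 𝓘(ℝ, E₂))
    mdifferentiableAt_snd ((contMDiffAt_paramAt hx).mdifferentiableAt (by simp)) v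
  have h' := mfderiv_comp_apply x (I := 𝓘(ℝ, E₁ × E₂)) (I' := 𝓘(ℝ, E₂))
    (f := (Prod.snd : E₁ × E₂ → E₂))
    ((contMDiffAt_chart_symm p.2 hx.2).mdifferentiableAt (by simp))
    differentiableAt_snd.mdifferentiableAt v
  rw [mfderiv_eq_fderiv, fderiv_snd] at h'
  exact h.symm.trans h'

omit [IsManifold 𝓘(ℝ, E₁) ∞ N₁] [IsManifold 𝓘(ℝ, E₂) ∞ N₂] in
theorem TProd_ext {q : N₁ × N₂} {v w : TProd E₁ E₂ q} (h₁ : dfst q v = dfst q w)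
    (h₂ : dsnd q v = dsnd q w) : v = w := by
  rw [dfst, mfderiv_fst] at h₁
  rw [dsnd, mfderiv_snd] at h₂
  exact Prod.ext h₁ h₂

theorem dparamAt_mem_factor₁ (hx : x ∈ paramDomain E₁ E₂ p) (a : E₁) :
    dparamAt p x (a, 0) ∈ (factor₁ (paramAt p x) : Submodule ℝ (TProd E₁ E₂ (paramAt p x))) := by
  have h := dsnd_dparamAt hx (a, 0)
  exact h.trans (map_zero _)

theorem dparamAt_mem_factor₂ (hx : x ∈ paramDomain E₁ E₂ p) (c : E₂) :
    dparamAt p x (0, c) ∈ (factor₂ (paramAt p x) : Submodule ℝ (TProd E₁ E₂ (paramAt p x))) := by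
  have h := dfst_dparamAt hx (0, c)
  exact h.trans (map_zero _)

theorem exists_dparamAt_of_mem_factor₁ (hx : x ∈ paramDomain E₁ E₂ p)
    {v : TProd E₁ E₂ (paramAt p x)} (hv : v ∈ factor₁ (paramAt p x)) :
    ∃ a : E₁, dparamAt p x (a, 0) = v := by
  obtain ⟨a, ha⟩ := (bijective_mfderiv_chart_symm p.1 hx.1).2 (dfst (paramAt p x) v)
  refine ⟨a, TProd_ext ((dfst_dparamAt hx (a, 0)).trans ha) ?_⟩
  exact (show _ = _ from dparamAt_mem_factor₁ hx a).trans (show _ = _ from hv).symm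

theorem exists_dparamAt_of_mem_factor₂ (hx : x ∈ paramDomain E₁ E₂ p)
    {v : TProd E₁ E₂ (paramAt p x)} (hv : v ∈ factor₂ (paramAt p x)) :
    ∃ c : E₂, dparamAt p x (0, c) = v := by
  obtain ⟨c, hc⟩ := (bijective_mfderiv_chart_symm p.2 hx.2).2 (dsnd (paramAt p x) v)
  refine ⟨c, TProd_ext ?_ ((dsnd_dparamAt hx (0, c)).trans hc)⟩
  exact (show _ = _ from dparamAt_mem_factor₂ hx c).trans (show _ = _ from hv).symm

/-- The right side does not involve `x.2`: lengths of horizontal coordinate fields are constant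
along the second factor. -/
theorem warpedInner_dparamAt_horizontal
    (g₁ : ContMDiffRiemannianMetric 𝓘(ℝ, E₁) ∞ E₁ (fun x : N₁ => TangentSpace 𝓘(ℝ, E₁) x))
    (g₂ : ContMDiffRiemannianMetric 𝓘(ℝ, E₂) ∞ E₂ (fun x : N₂ => TangentSpace 𝓘(ℝ, E₂) x))
    (f : N₁ → ℝ) (hx : x ∈ paramDomain E₁ E₂ p) (a : E₁) :
    warpedInner g₁ g₂ f (paramAt p x) (dparamAt p x (a, 0)) (dparamAt p x (a, 0))
      = g₁.inner ((extChartAt 𝓘(ℝ, E₁) p.1).symm x.1)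
          (mfderiv 𝓘(ℝ, E₁) 𝓘(ℝ, E₁) (extChartAt 𝓘(ℝ, E₁) p.1).symm x.1 a)
          (mfderiv 𝓘(ℝ, E₁) 𝓘(ℝ, E₁) (extChartAt 𝓘(ℝ, E₁) p.1).symm x.1 a) := by
  have h : dsnd (paramAt p x) (dparamAt p x (a, 0)) = 0 := dparamAt_mem_factor₁ hx a
  rw [warpedInner, h, dfst_dparamAt hx, map_zero, mul_zero, add_zero]
  rfl

theorem warpedInner_factor₁_factor₂
    (g₁ : ContMDiffRiemannianMetric 𝓘(ℝ, E₁) ∞ E₁ (fun x : N₁ => TangentSpace 𝓘(ℝ, E₁) x))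
    (g₂ : ContMDiffRiemannianMetric 𝓘(ℝ, E₂) ∞ E₂ (fun x : N₂ => TangentSpace 𝓘(ℝ, E₂) x))
    (f : N₁ → ℝ) {q : N₁ × N₂} {v w : TProd E₁ E₂ q} (hv : v ∈ factor₁ q) (hw : w ∈ factor₂ q) :
    warpedInner g₁ g₂ f q v w = 0 := by
  have hv' : dsnd q v = 0 := hv
  have hw' : dfst q w = 0 := hw
  simp [warpedInner, hv', hw']

end ProductChart

/-! ### Application to the immersed warped product -/

section Immersion

variable {E : Type*} [NormedAddCommGroup E] [NormedSpace ℂ E] [FiniteDimensional ℂ E]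
  {M : Type*} [TopologicalSpace M] [ChartedSpace E M] [IsManifold 𝓘(ℂ, E) ω M]
  {E₁ : Type*} [NormedAddCommGroup E₁] [NormedSpace ℝ E₁]
  {N₁ : Type*} [TopologicalSpace N₁] [ChartedSpace E₁ N₁] [IsManifold 𝓘(ℝ, E₁) ∞ N₁]
  {E₂ : Type*} [NormedAddCommGroup E₂] [NormedSpace ℝ E₂]
  {N₂ : Type*} [TopologicalSpace N₂] [ChartedSpace E₂ N₂] [IsManifold 𝓘(ℝ, E₂) ∞ N₂]
  {g : Metric E M}
  {g₁ : ContMDiffRiemannianMetric 𝓘(ℝ, E₁) ∞ E₁ (fun x : N₁ => TangentSpace 𝓘(ℝ, E₁) x)}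
  {g₂ : ContMDiffRiemannianMetric 𝓘(ℝ, E₂) ∞ E₂ (fun x : N₂ => TangentSpace 𝓘(ℝ, E₂) x)}
  {f : N₁ → ℝ} {φ : N₁ × N₂ → M} {θ : N₁ × N₂ → ℝ}

theorem IsPointwiseSemiSlantWarpedProduct.exists_J_dmap
    (hφ : IsPointwiseSemiSlantWarpedProduct g g₁ g₂ f φ θ) (q : N₁ × N₂) {v : TProd E₁ E₂ q}
    (hv : v ∈ factor₁ q) :
    ∃ w ∈ (factor₁ q : Submodule ℝ (TProd E₁ E₂ q)),
      dmap E E₁ E₂ φ q w = J (φ q) (dmap E E₁ E₂ φ q v) := by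
  have h : J (φ q) (dmap E E₁ E₂ φ q v) ∈
      (factor₁ q : Submodule ℝ (TProd E₁ E₂ q)).map (dmap E E₁ E₂ φ q).toLinearMap := by
    rw [← hφ.holomorphic q]
    exact Submodule.mem_map_of_mem (Submodule.mem_map_of_mem hv)
  exact h

/-- The fundamental form pairs the two factors trivially. -/
theorem IsPointwiseSemiSlantWarpedProduct.fundamentalForm_factor₁_factor₂
    (hφ : IsPointwiseSemiSlantWarpedProduct g g₁ g₂ f φ θ) (hg : IsLCK g) (q : N₁ × N₂)
    {v w : TProd E₁ E₂ q} (hv : v ∈ factor₁ q) (hw : w ∈ factor₂ q) :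
    fundamentalForm g (φ q) (dmap E E₁ E₂ φ q v) (dmap E E₁ E₂ φ q w) = 0 := by
  obtain ⟨v', hv', h⟩ := hφ.exists_J_dmap q hv
  -- Moving `J` to the horizontal argument keeps that argument horizontal, and the factors are
  -- orthogonal.
  rw [fundamentalForm, ← neg_eq_zero, ← inner_J_left g hg, ← h, hφ.isometric]
  exact warpedInner_factor₁_factor₂ g₁ g₂ f hv' hw

theorem IsPointwiseSemiSlantWarpedProduct.mfderiv_comp_paramAt
    (hφ : IsPointwiseSemiSlantWarpedProduct g g₁ g₂ f φ θ) {p : N₁ × N₂} {x : E₁ × E₂}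
    (hx : x ∈ paramDomain E₁ E₂ p) (v : E₁ × E₂) :
    mfderiv 𝓘(ℝ, E₁ × E₂) 𝓘(ℝ, E) (φ ∘ paramAt p) x v
      = dmap E E₁ E₂ φ (paramAt p x) (dparamAt p x v) :=
  mfderiv_comp_apply x ((hφ.smooth _).mdifferentiableAt (by simp))
    ((contMDiffAt_paramAt hx).mdifferentiableAt (by simp)) v

theorem IsPointwiseSemiSlantWarpedProduct.leeForm_dmap_factor₂
    (hφ : IsPointwiseSemiSlantWarpedProduct g g₁ g₂ f φ θ) (hg : IsLCK g)
    {α : Π x : M, TangentSpace 𝓘(ℝ, E) x →L[ℝ] ℝ} (hα : IsLeeForm g α) [Nontrivial E₁]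
    (q : N₁ × N₂) {Z : TProd E₁ E₂ q} (hZ : Z ∈ factor₂ q) :
    α (φ q) (dmap E E₁ E₂ φ q Z) = 0 := by
  -- Replacing `q` by `paramAt p x` with `p` and `x` free avoids transport between tangent spaces
  -- along `paramAt_coordAt`.
  obtain ⟨p, x, hx, rfl⟩ : ∃ (p : N₁ × N₂), ∃ x ∈ paramDomain E₁ E₂ p, paramAt p x = q :=
    ⟨q, coordAt E₁ E₂ q, coordAt_mem_paramDomain q, paramAt_coordAt q⟩
  obtain ⟨c, rfl⟩ := exists_dparamAt_of_mem_factor₂ hx hZ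
  obtain ⟨a, ha⟩ := exists_ne (0 : E₁)
  obtain ⟨v, hv, hJ⟩ := hφ.exists_J_dmap _ (dparamAt_mem_factor₁ hx a)
  -- The coordinate vector `b` represents `J` of the image of `a` at `x`; this is not claimed at
  -- nearby points.
  obtain ⟨b, rfl⟩ := exists_dparamAt_of_mem_factor₁ hx hv
  have hdom : ∀ᶠ y in 𝓝 x, y ∈ paramDomain E₁ E₂ p := (isOpen_paramDomain p).mem_nhds hx
  have hmixed : ∀ u : E₁, ∀ᶠ y in 𝓝 x, pullbackForm g (φ ∘ paramAt p) (u, 0) (0, c) y = 0 :=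
    fun u => by
    filter_upwards [hdom] with y hy
    rw [pullbackForm, hφ.mfderiv_comp_paramAt hy, hφ.mfderiv_comp_paramAt hy]
    exact hφ.fundamentalForm_factor₁_factor₂ hg _ (dparamAt_mem_factor₁ hy u)
      (dparamAt_mem_factor₂ hy c)
  have hline : ∀ᶠ t : ℝ in 𝓝 0, x + t • ((0 : E₁), c) ∈ paramDomain E₁ E₂ p := by
    have hc : Continuous fun t : ℝ => x + t • ((0 : E₁), c) := by fun_prop
    exact hc.continuousAt.eventually_mem ((isOpen_paramDomain p).mem_nhds (by simpa using hx))
  have hnorm : ∀ u : E₁, ∀ y ∈ paramDomain E₁ E₂ p,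
      g.inner ((φ ∘ paramAt p) y) (mfderiv 𝓘(ℝ, E₁ × E₂) 𝓘(ℝ, E) (φ ∘ paramAt p) y (u, 0))
        (mfderiv 𝓘(ℝ, E₁ × E₂) 𝓘(ℝ, E) (φ ∘ paramAt p) y (u, 0))
      = g₁.inner ((extChartAt 𝓘(ℝ, E₁) p.1).symm y.1)
          (mfderiv 𝓘(ℝ, E₁) 𝓘(ℝ, E₁) (extChartAt 𝓘(ℝ, E₁) p.1).symm y.1 u)
          (mfderiv 𝓘(ℝ, E₁) 𝓘(ℝ, E₁) (extChartAt 𝓘(ℝ, E₁) p.1).symm y.1 u) := fun u y hy => by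
    rw [hφ.mfderiv_comp_paramAt hy, ← warpedInner_dparamAt_horizontal g₁ g₂ f hy u]
    exact hφ.isometric _ _ _
  have hconst : ∀ u : E₁, ∀ᶠ t : ℝ in 𝓝 0,
      g.inner ((φ ∘ paramAt p) (x + t • ((0 : E₁), c)))
        (mfderiv 𝓘(ℝ, E₁ × E₂) 𝓘(ℝ, E) (φ ∘ paramAt p) (x + t • ((0 : E₁), c)) (u, 0))
        (mfderiv 𝓘(ℝ, E₁ × E₂) 𝓘(ℝ, E) (φ ∘ paramAt p) (x + t • ((0 : E₁), c)) (u, 0))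
      = g₁.inner ((extChartAt 𝓘(ℝ, E₁) p.1).symm x.1)
          (mfderiv 𝓘(ℝ, E₁) 𝓘(ℝ, E₁) (extChartAt 𝓘(ℝ, E₁) p.1).symm x.1 u)
          (mfderiv 𝓘(ℝ, E₁) 𝓘(ℝ, E₁) (extChartAt 𝓘(ℝ, E₁) p.1).symm x.1 u) := fun u => by
    filter_upwards [hline] with t ht
    -- The line in direction `(0, c)` keeps the first coordinate fixed, and the lengths depend on
    -- nothing else.
    have hfst : (x + t • ((0 : E₁), c)).1 = x.1 := by simp
    rw [hnorm u _ ht, hfst]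
  have hsmooth : ContMDiffAt 𝓘(ℝ, E₁ × E₂) 𝓘(ℝ, E) 2 (φ ∘ paramAt p) x :=
    ((hφ.smooth _).comp x (contMDiffAt_paramAt hx)).of_le ENat.LEInfty.out
  rw [← hφ.mfderiv_comp_paramAt hx]
  refine leeForm_eq_zero hg hα hsmooth (hmixed a) (hmixed b) (hconst a) (hconst b) ?_ ?_
  · rw [hφ.mfderiv_comp_paramAt hx, hφ.mfderiv_comp_paramAt hx]
    exact hJ
  -- By isometry a zero image would give a nonzero vector of the first factor zero `g₁`-length.
  · intro h0
    have hne : mfderiv 𝓘(ℝ, E₁) 𝓘(ℝ, E₁) (extChartAt 𝓘(ℝ, E₁) p.1).symm x.1 a ≠ 0 := fun h =>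
      ha ((bijective_mfderiv_chart_symm p.1 hx.1).1 (h.trans (map_zero _).symm))
    have h1 := hnorm a x hx
    rw [h0, map_zero] at h1
    exact (g₁.pos _ _ hne).ne h1

end Immersion

end LCK

end

theorem proposition4p1
    {E : Type*} [NormedAddCommGroup E] [NormedSpace ℂ E] [FiniteDimensional ℂ E]
    {M : Type*} [TopologicalSpace M] [ChartedSpace E M] [IsManifold 𝓘(ℂ, E) ω M]
    {E₁ : Type*} [NormedAddCommGroup E₁] [NormedSpace ℝ E₁] [FiniteDimensional ℝ E₁]
    {N₁ : Type*} [TopologicalSpace N₁] [ChartedSpace E₁ N₁] [IsManifold 𝓘(ℝ, E₁) ∞ N₁]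
    {E₂ : Type*} [NormedAddCommGroup E₂] [NormedSpace ℝ E₂] [FiniteDimensional ℝ E₂]
    {N₂ : Type*} [TopologicalSpace N₂] [ChartedSpace E₂ N₂] [IsManifold 𝓘(ℝ, E₂) ∞ N₂]
    (g : LCK.Metric E M) (hg : LCK.IsLCK g)
    (α : Π x : M, TangentSpace 𝓘(ℝ, E) x →L[ℝ] ℝ) (hα : LCK.IsLeeForm g α)
    (g₁ : ContMDiffRiemannianMetric 𝓘(ℝ, E₁) ∞ E₁ (fun x : N₁ => TangentSpace 𝓘(ℝ, E₁) x))
    (g₂ : ContMDiffRiemannianMetric 𝓘(ℝ, E₂) ∞ E₂ (fun x : N₂ => TangentSpace 𝓘(ℝ, E₂) x))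
    (f : N₁ → ℝ) (φ : N₁ × N₂ → M) (θ : N₁ × N₂ → ℝ)
    (hφ : LCK.IsPointwiseSemiSlantWarpedProduct g g₁ g₂ f φ θ)
    (hdim : Module.finrank ℝ E₁ ≠ 0) (hproper : ∀ p, 0 < Real.cos (θ p) ^ 2) :
    ∀ (p : N₁ × N₂), ∀ Z ∈ (LCK.factor₂ p : Submodule ℝ (LCK.TProd E₁ E₂ p)),
      g.inner (φ p) (LCK.sharp g α (φ p)) (LCK.dmap E E₁ E₂ φ p Z) = 0 := by
  intro p Z hZ
  have : Nontrivial E₁ := Module.nontrivial_of_finrank_pos (Nat.pos_of_ne_zero hdim)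
  rw [LCK.inner_sharp]
  exact hφ.leeForm_dmap_factor₂ hg hα p hZ
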